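/- Let $H$ be a complex Hilbert space and let $A$ be a nonzero bounded positive semidefinite operator on $H$ (its range need not be closed). Put $\|\xi\|_A=\langle A\xi,\xi\rangle^{1/2}$ for $\xi\in H$, and for a bounded operator $T$ on $H$ put $$\|T\|_A=\sup\Big\{\frac{\|T\xi\|_A}{\|\xi\|_A} : \xi\in\overline{R(A)},\ \xi\neq 0\Big\},$$ where $R(\cdot)$ denotes the range. Let $B_{A^{1/2}}(H)$ be the set of bounded operators $T$ on $H$ with $R(T^*A^{1/2})\subseteq R(A^{1/2})$ (for these, $\|T\|_A<\infty$). For $T\in B_{A^{1/2}}(H)$ let $T^{\diamond}$ be the unique bounded operator with $A^{1/2}T^{\diamond}=T^*A^{1/2}$ and $R(T^{\diamond})\subseteq\overline{R(A^{1/2})}$; then $T^{\diamond}\in B_{A^{1/2}}(H)$ as well. A nonzero $T\in B_{A^{1/2}}(H)$ is called $A$-invertible in $B_{A^{1/2}}(H)$ if there is a nonzero $S\in B_{A^{1/2}}(H)$ with $ATS=AST=A$. For $T\in B_{A^{1/2}}(H)$ let $\rho_A(T)$ be the set of $\lambda\in\mathbb{C}$ such that $\lambda I-T$ is $A$-invertible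 in $B_{A^{1/2}}(H)$, and let $\sigma_A(T)=\mathbb{C}\setminus\rho_A(T)$. Then for every $T\in B_{A^{1/2}}(H)$: 1. if $\lambda\in\mathbb{C}$ satisfies $\|T\|_A<|\lambda|$ and $\|T^{\diamond}\|_A<|\lambda|$, then $\lambda\in\rho_A(T^{\diamond})$; 2. $|\lambda|\le\max\{\|T\|_A,\|T^{\diamond}\|_A\}$ for every $\lambda\in\sigma_A(T)$; 3. $\sigma_A(T)$ is a bounded subset of $\mathbb{C}$. -/

import Mathlib

noncomputable section

namespace SemiHilbert

variable {H : Type*} [NormedAddCommGroup H] [InnerProductSpace ℂ H] [CompleteSpace H]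

/-- The positive square root `A^{1/2}` of a positive operator `A`. -/
def sqrtOp (A : H →L[ℂ] H) : H →L[ℂ] H := CFC.sqrt A

theorem adjoint_sqrtOp (A : H →L[ℂ] H) : (sqrtOp A).adjoint = sqrtOp A :=
  (IsSelfAdjoint.of_nonneg (CFC.sqrt_nonneg A)).star_eq

theorem sqrtOp_mul_self {A : H →L[ℂ] H} (hA : A.IsPositive) : sqrtOp A * sqrtOp A = A :=
  CFC.sqrt_mul_sqrt_self A ((ContinuousLinearMap.nonneg_iff_isPositive A).2 hA)

/-- The seminorm `‖ξ‖_A = ⟨Aξ, ξ⟩^{1/2}`. For positive `A` the number `⟨Aξ, ξ⟩` is real and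
nonnegative. -/
def vecSeminorm (A : H →L[ℂ] H) (ξ : H) : ℝ := Real.sqrt (inner ℂ (A ξ) ξ).re

/-- The operator seminorm `‖T‖_A`: the supremum of `‖Tξ‖_A / ‖ξ‖_A` over the nonzero `ξ` in the
closure of the range of `A`. -/
def opSeminorm (A T : H →L[ℂ] H) : ℝ :=
  sSup {r : ℝ | ∃ ξ ∈ closure (Set.range A), ξ ≠ 0 ∧
    r = vecSeminorm A (T ξ) / vecSeminorm A ξ}

/-- The set `B_{A^{1/2}}(H)` of the bounded operators `T` with `R(T* A^{1/2}) ⊆ R(A^{1/2})`. -/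
def sqrtBounded (A : H →L[ℂ] H) : Set (H →L[ℂ] H) :=
  {T | Set.range (T.adjoint ∘L sqrtOp A) ⊆ Set.range (sqrtOp A)}

/-- `D` is the reduced solution of `A^{1/2} X = T* A^{1/2}`. -/
def IsReducedSolution (A T D : H →L[ℂ] H) : Prop :=
  T.adjoint ∘L sqrtOp A = sqrtOp A ∘L D ∧ Set.range D ⊆ closure (Set.range (sqrtOp A))

theorem closure_range_sqrtOp (A : H →L[ℂ] H) :
    closure (Set.range (sqrtOp A)) = ((sqrtOp A).ker)ᗮ := by
  have h := ContinuousLinearMap.orthogonal_ker (sqrtOp A)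
  rw [adjoint_sqrtOp] at h
  rw [h, Submodule.topologicalClosure_coe]
  rfl

/-- Existence and uniqueness of the reduced solution for `T` in `B_{A^{1/2}}(H)`. -/
theorem existsUnique_reducedSolution {A T : H →L[ℂ] H} (hT : T ∈ sqrtBounded A) :
    ∃! D : H →L[ℂ] H, IsReducedSolution A T D := by
  set B := sqrtOp A with hB
  set K : Submodule ℂ H := B.kerᗮ with hK
  have hcl : closure (Set.range B) = (K : Set H) := closure_range_sqrtOp A
  have inj : ∀ y ∈ K, ∀ z ∈ K, B y = B z → y = z := by
    intro y hy z hz h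
    have h1 : y - z ∈ B.ker := by
      rw [LinearMap.mem_ker]
      simp [h]
    have h2 : y - z ∈ K := K.sub_mem hy hz
    have h3 : inner ℂ (y - z) (y - z) = 0 := (Submodule.mem_orthogonal _ _).1 h2 _ h1
    exact sub_eq_zero.1 (inner_self_eq_zero.1 h3)
  have ex : ∀ x, ∃ y ∈ K, B y = T.adjoint (B x) := by
    intro x
    obtain ⟨w, hw⟩ := hT ⟨x, rfl⟩
    have hc : IsClosed (B.ker : Set H) := B.isClosed_ker
    have : CompleteSpace B.ker := hc.completeSpace_coe
    obtain ⟨u, hu, v, hv, huv⟩ := B.ker.exists_add_mem_mem_orthogonal w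
    refine ⟨v, hv, ?_⟩
    have hu' : B u = 0 := hu
    have : B w = B v := by rw [huv, map_add, hu', zero_add]
    rw [← this]
    exact hw
  choose f hfK hf using ex
  let L : H →ₗ[ℂ] H :=
    { toFun := f
      map_add' := fun x y => inj _ (hfK _) _ (K.add_mem (hfK _) (hfK _)) (by simp [hf])
      map_smul' := fun c x => inj _ (hfK _) _ (K.smul_mem _ (hfK _)) (by simp [hf]) }
  have hL : Continuous L := by
    refine L.continuous_of_seq_closed_graph ?_
    intro u x y hu hy
    have hKc : IsClosed (K : Set H) := Submodule.isClosed_orthogonal _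
    have hyK : y ∈ K := hKc.mem_of_tendsto hy (Filter.Eventually.of_forall fun n => hfK (u n))
    refine inj _ hyK _ (hfK x) ?_
    have h1 : Filter.Tendsto (fun n => B (f (u n))) Filter.atTop (nhds (B y)) :=
      (B.continuous.tendsto y).comp hy
    have h2 : Filter.Tendsto (fun n => B (f (u n))) Filter.atTop (nhds (B (f x))) := by
      simp only [hf]
      exact ((T.adjoint ∘L B).continuous.tendsto x).comp hu
    exact tendsto_nhds_unique h1 h2
  refine ⟨⟨L, hL⟩, ⟨?_, ?_⟩, ?_⟩
  · ext x
    exact (hf x).symm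
  · rintro _ ⟨x, rfl⟩
    rw [← hB, hcl]
    exact hfK x
  · rintro D ⟨h1, h2⟩
    ext x
    refine inj _ ?_ _ (hfK x) ?_
    · have := h2 ⟨x, rfl⟩
      rw [← hB, hcl] at this
      exact this
    · refine Eq.trans ?_ (hf x).symm
      exact (DFunLike.congr_fun h1 x).symm

/-- The operator `T^⋄`: the unique reduced solution of `A^{1/2} X = T* A^{1/2}`. -/
def diamond (A T : H →L[ℂ] H) (hT : T ∈ sqrtBounded A) : H →L[ℂ] H :=
  (existsUnique_reducedSolution hT).choose

theorem diamond_spec {A T : H →L[ℂ] H} (hT : T ∈ sqrtBounded A) :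
    IsReducedSolution A T (diamond A T hT) :=
  (existsUnique_reducedSolution hT).choose_spec.1

/-- `T` is `A`-invertible in `B_{A^{1/2}}(H)`. -/
def IsAInvertible (A T : H →L[ℂ] H) : Prop :=
  T ∈ sqrtBounded A ∧ T ≠ 0 ∧
    ∃ S ∈ sqrtBounded A, S ≠ 0 ∧ A ∘L T ∘L S = A ∧ A ∘L S ∘L T = A

/-- The `A`-resolvent set `ρ_A(T)`. -/
def aResolventSet (A T : H →L[ℂ] H) : Set ℂ :=
  {z | IsAInvertible A (z • ContinuousLinearMap.id ℂ H - T)}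

/-- The `A`-spectrum `σ_A(T)`. -/
def aSpectrum (A T : H →L[ℂ] H) : Set ℂ := (aResolventSet A T)ᶜ

theorem vecSeminorm_eq {A : H →L[ℂ] H} (hA : A.IsPositive) (ξ : H) :
    vecSeminorm A ξ = ‖sqrtOp A ξ‖ := by
  have h : inner ℂ (A ξ) ξ = inner ℂ (sqrtOp A ξ) (sqrtOp A ξ) := by
    conv_lhs => rw [← sqrtOp_mul_self hA]
    rw [← ContinuousLinearMap.adjoint_inner_left, adjoint_sqrtOp]
    rfl
  rw [vecSeminorm, h, norm_eq_sqrt_re_inner (𝕜 := ℂ)]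
  rfl

/-- The supremum defining `‖T‖_A` is finite for `T` in `B_{A^{1/2}}(H)`. -/
theorem bddAbove_opSeminorm {A T : H →L[ℂ] H} (hA : A.IsPositive) (hT : T ∈ sqrtBounded A) :
    BddAbove {r : ℝ | ∃ ξ ∈ closure (Set.range A), ξ ≠ 0 ∧
      r = vecSeminorm A (T ξ) / vecSeminorm A ξ} := by
  refine ⟨‖(diamond A T hT).adjoint‖, ?_⟩
  rintro _ ⟨ξ, -, -, rfl⟩
  rw [vecSeminorm_eq hA, vecSeminorm_eq hA]
  refine div_le_of_le_mul₀ (norm_nonneg _) (norm_nonneg _) ?_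
  have h := congrArg ContinuousLinearMap.adjoint (diamond_spec hT).1
  rw [ContinuousLinearMap.adjoint_comp, ContinuousLinearMap.adjoint_comp,
    ContinuousLinearMap.adjoint_adjoint, adjoint_sqrtOp] at h
  have h' : sqrtOp A (T ξ) = (diamond A T hT).adjoint (sqrtOp A ξ) := DFunLike.congr_fun h ξ
  rw [h']
  exact ContinuousLinearMap.le_opNorm _ _

/-- `T^⋄` again belongs to `B_{A^{1/2}}(H)`. -/
theorem diamond_mem {A T : H →L[ℂ] H} (hT : T ∈ sqrtBounded A) :
    diamond A T hT ∈ sqrtBounded A := by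
  have h := congrArg ContinuousLinearMap.adjoint (diamond_spec hT).1
  rw [ContinuousLinearMap.adjoint_comp, ContinuousLinearMap.adjoint_comp,
    ContinuousLinearMap.adjoint_adjoint, adjoint_sqrtOp] at h
  rintro _ ⟨x, rfl⟩
  rw [← h]
  exact ⟨T x, rfl⟩

end SemiHilbert

end

namespace SemiHilbert

section

variable {H : Type*} [NormedAddCommGroup H] [InnerProductSpace ℂ H]

/-! Write `B = A^{1/2}`, `D = T^⋄`, `E = D^⋄`. Then `B T = D* B = B E`, so `A` cannot tell `T` from
`E`, while `E` has the ordinary bound `‖E‖ ≤ ‖D‖_A` (`norm_diamond_le_opSeminorm`). For `‖D‖_A <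
|z|` the ordinary inverse `S` of `z - E` is thus a candidate `A`-inverse of `z - T`. The condition
`‖T‖_A < |z|` makes `conj z - D` invertible, which puts `S` in `B_{A^{1/2}}(H)`. -/

theorem opSeminorm_nonneg (A T : H →L[ℂ] H) : 0 ≤ opSeminorm A T := by
  apply Real.sSup_nonneg
  rintro _ ⟨ξ, -, -, rfl⟩
  exact div_nonneg (Real.sqrt_nonneg _) (Real.sqrt_nonneg _)

variable [CompleteSpace H]

theorem adjoint_apply_diamond {A T : H →L[ℂ] H} (hT : T ∈ sqrtBounded A) (x : H) :
    T.adjoint (sqrtOp A x) = sqrtOp A (diamond A T hT x) :=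
  DFunLike.congr_fun (diamond_spec hT).1 x

theorem sqrtOp_apply_eq {A T : H →L[ℂ] H} (hT : T ∈ sqrtBounded A) (x : H) :
    sqrtOp A (T x) = (diamond A T hT).adjoint (sqrtOp A x) := by
  have h := congrArg ContinuousLinearMap.adjoint (diamond_spec hT).1
  rw [ContinuousLinearMap.adjoint_comp, ContinuousLinearMap.adjoint_comp,
    ContinuousLinearMap.adjoint_adjoint, adjoint_sqrtOp] at h
  exact DFunLike.congr_fun h x

theorem sqrtOp_diamond_diamond {A T : H →L[ℂ] H} (hT : T ∈ sqrtBounded A) (x : H) :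
    sqrtOp A (diamond A (diamond A T hT) (diamond_mem hT) x) = sqrtOp A (T x) := by
  rw [← adjoint_apply_diamond, sqrtOp_apply_eq hT]

theorem sqrtOp_eq_zero_of_apply_eq_zero {A : H →L[ℂ] H} (hA : A.IsPositive) {u : H}
    (hu : A u = 0) : sqrtOp A u = 0 := by
  rw [← norm_eq_zero, ← vecSeminorm_eq hA, vecSeminorm, hu]
  simp

/-- The values of `A^{1/2}` are attained on the closure of the range of `A`. -/
theorem exists_mem_closure_range_sqrtOp_eq {A : H →L[ℂ] H} (hA : A.IsPositive) (x : H) :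
    ∃ y ∈ closure (Set.range A), sqrtOp A y = sqrtOp A x := by
  have hcl : closure (Set.range A) = (A.kerᗮ : Set H) := by
    have h := ContinuousLinearMap.orthogonal_ker A
    rw [hA.isSelfAdjoint.adjoint_eq] at h
    rw [h, Submodule.topologicalClosure_coe]
    rfl
  have : CompleteSpace A.ker := A.isClosed_ker.completeSpace_coe
  obtain ⟨u, hu, v, hv, rfl⟩ := A.ker.exists_add_mem_mem_orthogonal x
  refine ⟨v, by rw [hcl]; exact hv, ?_⟩
  rw [map_add, sqrtOp_eq_zero_of_apply_eq_zero hA hu, zero_add]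

/-- The supremum ranges only over the closure of `R(A)`, but by `B T = D* B` both sides depend on
`x` only through `B x`. -/
theorem norm_sqrtOp_apply_le {A T : H →L[ℂ] H} (hA : A.IsPositive) (hT : T ∈ sqrtBounded A)
    (x : H) : ‖sqrtOp A (T x)‖ ≤ opSeminorm A T * ‖sqrtOp A x‖ := by
  obtain ⟨y, hy, hyx⟩ := exists_mem_closure_range_sqrtOp_eq hA x
  rw [sqrtOp_apply_eq hT, ← hyx, ← sqrtOp_apply_eq hT]
  rcases eq_or_ne (sqrtOp A y) 0 with h0 | h0
  · rw [sqrtOp_apply_eq hT, h0]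
    simp
  · have hy0 : y ≠ 0 := by
      rintro rfl
      exact h0 (map_zero _)
    rw [← div_le_iff₀ (norm_pos_iff.2 h0), ← vecSeminorm_eq hA, ← vecSeminorm_eq hA]
    exact le_csSup (bddAbove_opSeminorm hA hT) ⟨y, hy, hy0, rfl⟩

/-- `D* B = B T` bounds `D*` on the closure of `R(B)`, where `D` takes its values; then use `‖D x‖²
= ⟨D* D x, x⟩`. -/
theorem norm_diamond_le_opSeminorm {A T : H →L[ℂ] H} (hA : A.IsPositive)
    (hT : T ∈ sqrtBounded A) : ‖diamond A T hT‖ ≤ opSeminorm A T := by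
  set D := diamond A T hT with hD
  have hK : ∀ y ∈ closure (Set.range (sqrtOp A)), ‖D.adjoint y‖ ≤ opSeminorm A T * ‖y‖ := by
    have hc : IsClosed {y : H | ‖D.adjoint y‖ ≤ opSeminorm A T * ‖y‖} :=
      isClosed_le (by fun_prop) (by fun_prop)
    refine fun y hy => closure_minimal ?_ hc hy
    rintro _ ⟨x, rfl⟩
    rw [Set.mem_ofPred_eq, hD, ← sqrtOp_apply_eq hT]
    exact norm_sqrtOp_apply_le hA hT x
  refine D.opNorm_le_bound (opSeminorm_nonneg A T) fun x => ?_
  have h1 : ‖D x‖ * ‖D x‖ ≤ opSeminorm A T * ‖x‖ * ‖D x‖ := by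
    calc ‖D x‖ * ‖D x‖ = ‖inner ℂ (D.adjoint (D x)) x‖ := by
          rw [ContinuousLinearMap.adjoint_inner_left, inner_self_eq_norm_sq_to_K]
          simp [sq]
      _ ≤ ‖D.adjoint (D x)‖ * ‖x‖ := norm_inner_le_norm _ _
      _ ≤ opSeminorm A T * ‖D x‖ * ‖x‖ := by
          gcongr
          exact hK _ ((diamond_spec hT).2 ⟨x, rfl⟩)
      _ = opSeminorm A T * ‖x‖ * ‖D x‖ := by ring
  rcases (norm_nonneg (D x)).eq_or_lt with h | h
  · rw [← h]
    exact mul_nonneg (opSeminorm_nonneg A T) (norm_nonneg _)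
  · exact le_of_mul_le_mul_right h1 h

theorem opSeminorm_diamond_diamond {A T : H →L[ℂ] H} (hA : A.IsPositive)
    (hT : T ∈ sqrtBounded A) :
    opSeminorm A (diamond A (diamond A T hT) (diamond_mem hT)) = opSeminorm A T := by
  simp only [opSeminorm, vecSeminorm_eq hA, sqrtOp_diamond_diamond]

theorem exists_inverse_smul_one_sub {E : H →L[ℂ] H} {z : ℂ} (h : ‖E‖ < ‖z‖) :
    ∃ S : H →L[ℂ] H, (z • 1 - E) * S = 1 ∧ S * (z • 1 - E) = 1 := by
  -- The resolvent estimate needs `‖1‖ = 1`, which fails on the zero space.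
  rcases (subsingleton_or_nontrivial H).symm with h0 | h0
  · have hz : z ∈ resolventSet ℂ E := spectrum.mem_resolventSet_of_norm_lt h
    rw [spectrum.mem_resolventSet_iff, Algebra.algebraMap_eq_smul_one] at hz
    obtain ⟨u, hu⟩ := hz
    exact ⟨↑u⁻¹, by rw [← hu, u.mul_inv], by rw [← hu, u.inv_mul]⟩
  · exact ⟨0, Subsingleton.elim _ _, Subsingleton.elim _ _⟩

theorem mem_aResolventSet_of_opSeminorm_lt {A T : H →L[ℂ] H} (hA : A.IsPositive) (hA0 : A ≠ 0)
    (hT : T ∈ sqrtBounded A) {z : ℂ} (h1 : opSeminorm A T < ‖z‖)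
    (h2 : opSeminorm A (diamond A T hT) < ‖z‖) : z ∈ aResolventSet A T := by
  set D := diamond A T hT with hD
  set E := diamond A D (diamond_mem hT) with hE
  set B := sqrtOp A with hB
  have hBB : B * B = A := sqrtOp_mul_self hA
  have hBadj : star B = B := adjoint_sqrtOp A
  have hTD : star T * B = B * D := (diamond_spec hT).1
  have hDE : star D * B = B * E := (diamond_spec (diamond_mem hT)).1
  have hED : star E * B = B * D := by
    have := congrArg star hDE
    rw [star_mul, star_mul, star_star, hBadj] at this
    exact this.symm
  have hBT : B * T = star D * B := by
    have := congrArg star hTD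
    rwa [star_mul, star_mul, star_star, hBadj] at this
  have hDn : ‖D‖ < ‖star z‖ := by
    rw [norm_star]
    exact (norm_diamond_le_opSeminorm hA hT).trans_lt h1
  have hEn : ‖E‖ < ‖z‖ := (norm_diamond_le_opSeminorm hA (diamond_mem hT)).trans_lt h2
  obtain ⟨R, hR1, -⟩ := exists_inverse_smul_one_sub hDn
  obtain ⟨S, hS1, hS2⟩ := exists_inverse_smul_one_sub hEn
  have hS3 : star S * (star z • 1 - star E) = 1 := by
    have := congrArg star hS1
    simpa only [star_mul, star_sub, star_smul, star_one] using this
  -- This intertwining gives the range condition on `S`; its adjoint `B S = R* B` serves for the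
  -- left inverse.
  have hSB : star S * B = B * R := by
    have hEB : (star z • 1 - star E) * B = B * (star z • 1 - D) := by
      rw [sub_mul, hED, mul_sub]
      simp
    calc star S * B = star S * (B * ((star z • 1 - D) * R)) := by rw [hR1, mul_one]
      _ = star S * ((star z • 1 - star E) * B) * R := by rw [hEB]; simp only [mul_assoc]
      _ = B * R := by rw [← mul_assoc, hS3, one_mul]
  have hzT : B * (z • 1 - T) = B * (z • 1 - E) := by
    rw [mul_sub, mul_sub, hBT, hDE]
  have hBS : B * S = star R * B := by
    have := congrArg star hSB
    rwa [star_mul, star_mul, star_star, hBadj] at this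
  have hright : B * ((z • 1 - T) * S) = B := by
    rw [← mul_assoc, hzT, mul_assoc, hS1, mul_one]
  -- `S` separates `B` from `z - T`: trade `B S` for `R* B`, replace `T` by `E`, and trade back.
  have hleft : B * (S * (z • 1 - T)) = B := by
    rw [← mul_assoc, hBS, mul_assoc, hzT, ← mul_assoc, ← hBS, mul_assoc, hS2, mul_one]
  have hB0 : B ≠ 0 := by
    intro h
    rw [h, mul_zero] at hBB
    exact hA0 hBB.symm
  refine ⟨?_, ?_, S, ?_, ?_, ?_, ?_⟩
  · rintro _ ⟨x, rfl⟩
    refine ⟨(star z • 1 - D) x, ?_⟩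
    have : star (z • 1 - T) * B = B * (star z • 1 - D) := by
      rw [star_sub, star_smul, star_one, sub_mul, hTD, mul_sub]
      simp
    exact (DFunLike.congr_fun this x).symm
  · intro h
    change z • 1 - T = 0 at h
    rw [h, zero_mul, mul_zero] at hright
    exact hB0 hright.symm
  · rintro _ ⟨x, rfl⟩
    exact ⟨R x, (DFunLike.congr_fun hSB x).symm⟩
  · rintro rfl
    rw [mul_zero, mul_zero] at hright
    exact hB0 hright.symm
  · change A * ((z • 1 - T) * S) = A
    rw [← hBB, mul_assoc, hright]
  · change A * (S * (z • 1 - T)) = A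
    rw [← hBB, mul_assoc, hleft]

end

end SemiHilbert

theorem mainTheorem6 {H : Type*} [NormedAddCommGroup H] [InnerProductSpace ℂ H] [CompleteSpace H]
    (A : H →L[ℂ] H) (hA : A.IsPositive) (hA0 : A ≠ 0)
    (T : H →L[ℂ] H) (hT : T ∈ SemiHilbert.sqrtBounded A) :
    (∀ z : ℂ, SemiHilbert.opSeminorm A T < ‖z‖ →
      SemiHilbert.opSeminorm A (SemiHilbert.diamond A T hT) < ‖z‖ →
      z ∈ SemiHilbert.aResolventSet A (SemiHilbert.diamond A T hT)) ∧
    (∀ z ∈ SemiHilbert.aSpectrum A T,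
      ‖z‖ ≤ max (SemiHilbert.opSeminorm A T)
        (SemiHilbert.opSeminorm A (SemiHilbert.diamond A T hT))) ∧
    Bornology.IsBounded (SemiHilbert.aSpectrum A T) := by
  have hle : ∀ z ∈ SemiHilbert.aSpectrum A T,
      ‖z‖ ≤ max (SemiHilbert.opSeminorm A T)
        (SemiHilbert.opSeminorm A (SemiHilbert.diamond A T hT)) := by
    intro z hz
    by_contra! h
    obtain ⟨h1, h2⟩ := max_lt_iff.1 h
    exact hz (SemiHilbert.mem_aResolventSet_of_opSeminorm_lt hA hA0 hT h1 h2)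
  refine ⟨fun z h1 h2 => ?_, hle, ?_⟩
  -- For `T^⋄` the two bounds swap roles, since `T^⋄⋄` and `T` have equal seminorms.
  · refine SemiHilbert.mem_aResolventSet_of_opSeminorm_lt hA hA0 (SemiHilbert.diamond_mem hT) h2 ?_
    rwa [SemiHilbert.opSeminorm_diamond_diamond hA hT]
  · exact isBounded_iff_forall_norm_le.2 ⟨_, hle⟩
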